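/- **Setting (MLAPD).** Let $\mathcal T$ be a finite rooted tree with root $r$ and node costs $c(v)>0$. The level $L_v$ of a node is the number of nodes on the path from $r$ to $v$, and the depth is $D=\max_v L_v$. For a node $w$ in the subtree $\mathcal T_v$ rooted at $v$, let $P(v\to w)$ be the set of nodes on the path from $v$ to $w$, both included. A request $\rho=(v_\rho,a_\rho,d_\rho)$ consists of a node, an arrival time and a deadline, $a_\rho\le d_\rho$; an instance is a finite set $\mathcal R$ of requests with pairwise distinct deadlines. A service $(S,t)$ is a subtree $S$ containing $r$ together with a transmission time $t$; it satisfies $\rho$ if $v_\rho\in S$ and $a_\rho\le t\le d_\rho$. A schedule is a finite collection of services; it is a solution for $\mathcal R$ if every request of $\mathcal R$ is satisfied by one of its services. Its cost is $\sum_{(S,t)}\sum_{v\in S}c(v)$. An algorithm that assigns a schedule to every instance is online if the services it transmits up to time $t$ depend only on the requests that have arrived by time $t$. It is $\alpha$-competitive if for every instance it produces a solution whose cost is at most $\alpha$ times the cost of every solution. **Algorithm Waterfall.** It maintains a price $p(v)$ for every node, initially $p(v)=c(v)$. Whenever a request $\rho$ becomes due (time $t=d_\rho$) and has not been satisfied by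 an earlier service, it does the following. A request is called pending if it has arrived by time $t$ and has not been satisfied by an earlier service. 1. Set $S=P(r\to v_\rho)$, put $p(v)=c(v)$ for all $v\in S$, and enqueue the nodes of $S$ into a queue $Q$. 2. While $Q\neq\varnothing$: dequeue a node $v$, run the $v$-fall, and enqueue all the nodes added to $S$ by this fall. 3. Transmit $S$ at time $t$. The $v$-fall starts with the budget $b=c(v)$ and goes through the pending requests $\sigma$ with $v_\sigma\in\mathcal T_v$ in increasing order of deadline. For each, let $P=P(v\to v_\sigma)\setminus S$ and $q=\sum_{u\in P}p(u)$. * If $q>b$, replace $p(u)$ by $p(u)(1-b/q)$ for every $u\in P$ and end the fall. * If $q\le b$, add $P$ to $S$, replace $b$ by $b-q$, set $p(u)=c(u)$ for $u\in P$, and continue with the next request. **Theorem.** Waterfall is a $D$-competitive online algorithm for MLAPD on every tree of depth $D$. This holds for every rule that fixes the order in which the elements of a set of nodes are enqueued. -/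

import Mathlib

/-!
Multi-level aggregation with deadlines (MLAPD) on a finite rooted tree `T`, and the online
algorithm Waterfall. Rooted trees are Mathlib's `RootedTree`: `u ≤ v` means that `u` is an ancestor
of `v` (or `v` itself), and the root is `⊥`. Node costs are given by `c : T → ℝ`.
-/

namespace MLAPD

noncomputable section

universe u

/-! ### The problem -/

/-- A request, issued at a node, with an arrival time and a deadline. -/
@[ext]
structure Request (T : RootedTree.{u}) where
  node : T
  arrival : ℝ
  deadline : ℝ

/-- A set of nodes together with a transmission time. -/
@[ext]
structure Service (T : RootedTree.{u}) where
  nodes : Finset T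
  time : ℝ

/-- The transmitted nodes form a subtree containing the root: the root belongs to the set, and the
set contains every ancestor of each of its nodes. -/
def Service.IsValid {T : RootedTree.{u}} (s : Service T) : Prop :=
  ⊥ ∈ s.nodes ∧ IsLowerSet (s.nodes : Set T)

/-- The service `s` satisfies the request `ρ`. -/
def Service.Satisfies {T : RootedTree.{u}} (s : Service T) (ρ : Request T) : Prop :=
  ρ.node ∈ s.nodes ∧ ρ.arrival ≤ s.time ∧ s.time ≤ ρ.deadline

/-- The admissible request sets: every request arrives no later than it is due, and the deadlines
are pairwise distinct. -/
def IsInstance {T : RootedTree.{u}} (R : Finset (Request T)) : Prop :=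
  (∀ ρ ∈ R, ρ.arrival ≤ ρ.deadline) ∧
    ∀ ρ ∈ R, ∀ σ ∈ R, ρ.deadline = σ.deadline → ρ = σ

/-- A schedule, listed service by service, is a solution for `R` if it consists of subtrees
containing the root and satisfies every request of `R`. -/
def IsSolution {T : RootedTree.{u}} (R : Finset (Request T)) (X : List (Service T)) : Prop :=
  (∀ s ∈ X, s.IsValid) ∧ ∀ ρ ∈ R, ∃ s ∈ X, s.Satisfies ρ

/-- The total cost of the nodes of all services of the schedule. -/
def cost {T : RootedTree.{u}} (c : T → ℝ) (X : List (Service T)) : ℝ :=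
  (X.map fun s => ∑ v ∈ s.nodes, c v).sum

open Classical in
/-- The level of `v`: the number of nodes on the path from the root to `v`. -/
def level {T : RootedTree.{u}} [Fintype T] (v : T) : ℕ :=
  (Finset.univ.filter fun w : T => w ≤ v).card

/-- The depth (number of levels) of the tree: the largest level of a node. -/
def depth (T : RootedTree.{u}) [Fintype T] : ℕ :=
  Finset.univ.sup fun v : T => level v

open Classical in
/-- `A`, which maps a request set to a schedule, is an online algorithm: the services transmitted
up to time `t` depend only on the requests that have arrived by time `t`. -/
def IsOnline {T : RootedTree.{u}} (A : Finset (Request T) → List (Service T)) : Prop :=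
  ∀ R R' : Finset (Request T), IsInstance R → IsInstance R' → ∀ t : ℝ,
    R.filter (fun ρ => ρ.arrival ≤ t) = R'.filter (fun ρ => ρ.arrival ≤ t) →
      (A R).filter (fun s => s.time ≤ t) = (A R').filter (fun s => s.time ≤ t)

/-- `A` is an `α`-competitive online algorithm: it is online, always produces a solution, and the
cost of that solution is at most `α` times the cost of any other solution. -/
def IsCompetitive {T : RootedTree.{u}} (c : T → ℝ) (A : Finset (Request T) → List (Service T))
    (α : ℝ) : Prop :=
  IsOnline A ∧ ∀ R : Finset (Request T), IsInstance R →
    IsSolution R (A R) ∧ ∀ X : List (Service T), IsSolution R X → cost c (A R) ≤ α * cost c X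

/-! ### The algorithm -/

open Classical in
/-- The nodes on the path from `v` down to its descendant `w`, both included. -/
def path {T : RootedTree.{u}} [Fintype T] (v w : T) : Finset T :=
  Finset.univ.filter fun x => v ≤ x ∧ x ≤ w

open Classical in
/-- The requests of `R`, listed in increasing deadline order. -/
def byDeadline {T : RootedTree.{u}} (R : Finset (Request T)) : List (Request T) :=
  R.toList.insertionSort fun ρ σ => ρ.deadline ≤ σ.deadline

open Classical in
/-- The loop of the `v`-fall over the remaining requests, with remaining budget `b`. The tentative
service tree is `S ∪ A`, where `S` is the tree at the start of the fall and `A` collects the nodes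
added by the fall so far; `p` holds the current prices. Returns the final `A` and `p`. -/
def fallLoop {T : RootedTree.{u}} [Fintype T] (c : T → ℝ) (v : T) (S : Finset T) :
    List (Request T) → ℝ → Finset T → (T → ℝ) → Finset T × (T → ℝ)
  | [], _, A, p => (A, p)
  | ρ :: l, b, A, p =>
    let P := path v ρ.node \ (S ∪ A)
    let q := ∑ x ∈ P, p x
    if q > b then
      (A, fun x => if x ∈ P then p x * (1 - b / q) else p x)
    else
      fallLoop c v S l (b - q) (A ∪ P) (fun x => if x ∈ P then c x else p x)

open Classical in
/-- The `v`-fall, started with budget `c v`. It considers the pending requests issued in the subtree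
rooted at `v` and returns the set of added nodes together with the new prices. -/
def fall {T : RootedTree.{u}} [Fintype T] (c : T → ℝ) (pending : Finset (Request T))
    (v : T) (S : Finset T) (p : T → ℝ) : Finset T × (T → ℝ) :=
  fallLoop c v S (byDeadline (pending.filter fun ρ => v ≤ ρ.node)) (c v) ∅ p

theorem fallLoop_disjoint {T : RootedTree.{u}} [Fintype T] (c : T → ℝ) (v : T) (S : Finset T)
    (l : List (Request T)) (b : ℝ) (A : Finset T) (p : T → ℝ) (h : Disjoint S A) :
    Disjoint S (fallLoop c v S l b A p).1 := by
  classical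
  induction l generalizing b A p with
  | nil => simpa [fallLoop] using h
  | cons ρ l ih =>
    simp only [fallLoop]
    split_ifs with hq
    · exact h
    · apply ih
      rw [Finset.disjoint_left] at h ⊢
      intro a ha hb
      simp only [Finset.mem_union, Finset.mem_sdiff] at hb
      rcases hb with hb | hb
      · exact h ha hb
      · exact hb.2 (Or.inl ha)

theorem fall_disjoint {T : RootedTree.{u}} [Fintype T] (c : T → ℝ) (pending : Finset (Request T))
    (v : T) (S : Finset T) (p : T → ℝ) : Disjoint S (fall c pending v S p).1 :=
  fallLoop_disjoint c v S _ _ _ _ (Finset.disjoint_empty_right S)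

/-- A rule that fixes the order in which the elements of a set of nodes are enqueued. -/
structure EnqueueRule (T : RootedTree.{u}) where
  toList : Finset T → List T
  spec : ∀ A : Finset T, (toList A : Multiset T) = A.val

theorem EnqueueRule.length_toList {T : RootedTree.{u}} (E : EnqueueRule T) (A : Finset T) :
    (E.toList A).length = A.card := by
  rw [← Multiset.coe_card, E.spec]
  rfl

open Classical in
/-- The loop of Waterfall: as long as the queue is nonempty, a node is dequeued, its fall is carried
out, and the nodes added by the fall are appended to the queue. Returns the service tree and the
prices once the queue is empty. -/
def queueLoop {T : RootedTree.{u}} [Fintype T] (c : T → ℝ) (E : EnqueueRule T)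
    (pending : Finset (Request T)) (Q : List T) (S : Finset T) (p : T → ℝ) :
    Finset T × (T → ℝ) :=
  match Q with
  | [] => (S, p)
  | v :: Q' =>
    queueLoop c E pending (Q' ++ E.toList (fall c pending v S p).1)
      (S ∪ (fall c pending v S p).1) (fall c pending v S p).2
termination_by Q.length + (Fintype.card T - S.card)
decreasing_by
  have h1 := Finset.card_union_of_disjoint (fall_disjoint c pending v S p)
  have h2 := Finset.card_le_univ (S ∪ (fall c pending v S p).1)
  have h3 := E.length_toList (fall c pending v S p).1
  simp only [List.length_append, List.length_cons]
  omega

/-- The current prices and the services transmitted so far, in chronological order. -/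
structure State (T : RootedTree.{u}) where
  price : T → ℝ
  sent : List (Service T)

open Classical in
/-- The requests of `R` that have arrived by time `t` and are not satisfied by a service of
`sent`. -/
def pendingAt {T : RootedTree.{u}} (R : Finset (Request T)) (sent : List (Service T)) (t : ℝ) :
    Finset (Request T) :=
  R.filter fun ρ => ρ.arrival ≤ t ∧ ¬ ∃ s ∈ sent, s.Satisfies ρ

open Classical in
/-- What Waterfall does at the deadline of `ρ`: nothing if `ρ` has already been satisfied; otherwise
it starts a service with the path from the root to `ρ`, resets the prices on that path, enqueues the
path, runs the queue loop and transmits the resulting tree. -/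
def waterfallStep {T : RootedTree.{u}} [Fintype T] (c : T → ℝ) (E : EnqueueRule T)
    (R : Finset (Request T)) (st : State T) (ρ : Request T) : State T :=
  if ∃ s ∈ st.sent, s.Satisfies ρ then st
  else
    let P := path ⊥ ρ.node
    let res := queueLoop c E (pendingAt R st.sent ρ.deadline) (E.toList P) P
      (fun v => if v ∈ P then c v else st.price v)
    ⟨res.2, st.sent ++ [⟨res.1, ρ.deadline⟩]⟩

/-- The schedule produced by Waterfall: all prices start at the costs, and the deadlines are handled
in chronological order. -/
def waterfall {T : RootedTree.{u}} [Fintype T] (c : T → ℝ) (E : EnqueueRule T)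
    (R : Finset (Request T)) : List (Service T) :=
  ((byDeadline R).foldl (waterfallStep c E R) ⟨c, []⟩).sent

end

end MLAPD

namespace MLAPD

noncomputable section

universe u

variable {T : RootedTree.{u}}

/-! The proof is a charging argument on pairs of a service and one of its nodes. The price reduction
that the `v`-fall of a service inflicts on a node `u` is read as a payment from `v` to `u`, credited
to the next service containing `u`, possibly the same one. The price of `u` is then the part of `c
u` not yet paid since its last service. So a served node receives at most its cost, and exactly its
cost unless it lies on the path to the request that triggered the service (`IsTrace.received_le`,
`IsTrace.received_eq`). Payments go strictly down the tree.

Fix a solution `O`. A node on the triggering path is always `Overdue`, so pairs that are not overdue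
are fully paid for. If a pair is overdue but not `Critical`, then `v` is overdue again before `O`
next serves it, because of some request `τ`. Since `O` must have served `τ` earlier, `τ` was already
pending and was left out; hence the `v`-fall spent its whole budget, on requests due no later than
`τ`, and every node it paid is overdue at its next service (`IsTrace.pays_of_not_critical`).

Costs of pairs that are not overdue can thus be traced up the tree, and costs of noncritical overdue
pairs down the tree, both ending at critical pairs. A critical pair of level `L` absorbs `D - L`
times its cost from the first kind, `L - 1` times from the second, and its own cost: `D` in all
(`sum_le_mul_sum_critical`). Critical pairs inject into the pairs of `O`, by `sum_critical_le_cost`.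
-/

/-! ### Paths and deadline order -/

open Classical in
theorem mem_path [Fintype T] {v w x : T} : x ∈ path v w ↔ v ≤ x ∧ x ≤ w := by
  simp [path]

theorem mem_byDeadline {R : Finset (Request T)} {ρ : Request T} : ρ ∈ byDeadline R ↔ ρ ∈ R := by
  simp [byDeadline]

theorem pairwise_byDeadline_le (R : Finset (Request T)) :
    (byDeadline R).Pairwise fun ρ σ => ρ.deadline ≤ σ.deadline := by
  classical
  have : Std.Total fun ρ σ : Request T => ρ.deadline ≤ σ.deadline :=
    ⟨fun a b => le_total a.deadline b.deadline⟩
  have : IsTrans (Request T) fun ρ σ => ρ.deadline ≤ σ.deadline :=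
    ⟨fun _ _ _ h₁ h₂ => le_trans h₁ h₂⟩
  exact List.pairwise_insertionSort _ _

theorem nodup_byDeadline (R : Finset (Request T)) : (byDeadline R).Nodup := by
  classical
  exact (List.perm_insertionSort _ _).nodup_iff.mpr R.nodup_toList

theorem pairwise_byDeadline_lt {R : Finset (Request T)} (hR : IsInstance R) :
    (byDeadline R).Pairwise fun ρ σ => ρ.deadline < σ.deadline := by
  refine ((pairwise_byDeadline_le R).and (nodup_byDeadline R)).imp_of_mem ?_
  intro ρ σ hρ hσ h
  exact lt_of_le_of_ne h.1 fun he =>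
    h.2 (hR.2 ρ (mem_byDeadline.mp hρ) σ (mem_byDeadline.mp hσ) he)

theorem isLowerSet_union_path [Fintype T] [DecidableEq T] {S : Finset T} {v w : T}
    (hS : IsLowerSet (S : Set T)) (hv : v ∈ S) :
    IsLowerSet ((S ∪ path v w : Finset T) : Set T) := by
  intro a b hba ha
  simp only [Finset.coe_union, Set.mem_union, Finset.mem_coe, mem_path] at ha ⊢
  rcases ha with ha | ha
  · exact Or.inl (hS hba ha)
  · rcases le_total_of_directed ha.1 hba with h | h
    · exact Or.inl (hS h hv)
    · exact Or.inr ⟨h, hba.trans ha.2⟩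

/-! ### The payments of a fall -/

/-- The `v`-fall over the requests `l`, with budget `b`, added set `A` and prices `p`, ends with the
added set `A'` and the prices `p'`, and pays the amount `Y u` to the node `u`. -/
structure FallPays (c : T → ℝ) (S : Finset T) (l : List (Request T)) (b : ℝ)
    (A : Finset T) (p : T → ℝ) (A' : Finset T) (p' : T → ℝ) [Fintype T] (Y : T → ℝ) : Prop where
  subset : A ⊆ A'
  price_pos : ∀ u, 0 < p' u
  nonneg : ∀ u, 0 ≤ Y u
  pay_old : ∀ u, u ∈ S ∨ u ∈ A → Y u = 0
  price_old : ∀ u, u ∈ S ∨ u ∈ A → p' u = p u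
  pay_added : ∀ u ∈ A', u ∉ A → Y u = p u
  price_added : ∀ u ∈ A', u ∉ A → p' u = c u
  price_rest : ∀ u, u ∉ A' → p' u = p u - Y u
  sum_le : ∑ u, Y u ≤ b
  -- Requests are tried in deadline order, so one that is left out certifies that all money went
  -- towards deadlines no later than its own.
  exhausted : ∀ τ ∈ l, τ.node ∉ S → τ.node ∉ A' → ∑ u, Y u = b ∧
    ∀ u, Y u ≠ 0 → ∃ σ ∈ l, u ≤ σ.node ∧ σ.deadline ≤ τ.deadline

-- Induction on the request list. An accepted path receives its full price and joins the accumulated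
-- set, which later requests never pay; the first rejected path absorbs exactly the remaining
-- budget.
open Classical in
theorem exists_fallPays [Fintype T] {c : T → ℝ} (hc : ∀ v, 0 < c v) {v : T}
    {S : Finset T} (hv : v ∈ S) (l : List (Request T))
    (hl : l.Pairwise fun ρ σ => ρ.deadline ≤ σ.deadline) (hlv : ∀ ρ ∈ l, v ≤ ρ.node)
    (b : ℝ) (hb : 0 ≤ b) (A : Finset T) (p : T → ℝ) (hp : ∀ u, 0 < p u)
    (hSA : IsLowerSet ((S ∪ A : Finset T) : Set T)) :
    IsLowerSet ((S ∪ (fallLoop c v S l b A p).1 : Finset T) : Set T) ∧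
    ∃ Y : T → ℝ, (∀ u, Y u ≠ 0 → v ≤ u) ∧
      FallPays c S l b A p (fallLoop c v S l b A p).1 (fallLoop c v S l b A p).2 Y := by
  induction l generalizing b A p with
  | nil =>
    refine ⟨by simpa [fallLoop] using hSA, 0, by simp, ?_⟩
    constructor <;> simp +contextual [fallLoop, hp, hb]
  | cons ρ l ih =>
    have hρ : v ≤ ρ.node := hlv ρ (by simp)
    obtain ⟨hρl, hl'⟩ := List.pairwise_cons.mp hl
    have hlv' : ∀ σ ∈ l, v ≤ σ.node := fun σ hσ => hlv σ (by simp [hσ])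
    simp only [fallLoop]
    set P := path v ρ.node \ (S ∪ A) with hP
    set q := ∑ x ∈ P, p x with hq
    have hPv : ∀ u ∈ P, v ≤ u ∧ u ≤ ρ.node ∧ u ∉ S ∧ u ∉ A := by
      intro u hu
      simp only [hP, Finset.mem_sdiff, mem_path, Finset.mem_union, not_or] at hu
      tauto
    split_ifs with hqb
    · have hq0 : 0 < q := hb.trans_lt hqb
      -- Scaling by `1 - b / q` amounts to paying `p u * (b / q)` to each node of the path.
      have hsum : ∑ u, (if u ∈ P then p u * (b / q) else 0) = b := by
        rw [← Finset.sum_filter]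
        simp only [Finset.filter_mem_eq_inter, Finset.univ_inter]
        rw [← Finset.sum_mul, ← hq]
        field_simp
      have hfac : 0 < 1 - b / q := by
        rw [sub_pos, div_lt_one hq0]; exact hqb
      refine ⟨hSA, fun u => if u ∈ P then p u * (b / q) else 0,
        fun u hu => ?_, ?_⟩
      · by_cases h : u ∈ P
        · exact (hPv u h).1
        · simp [h] at hu
      refine ⟨subset_rfl, fun u => ?_, fun u => ?_, fun u hu => ?_, fun u hu => ?_,
        fun u hu hu' => absurd hu hu', fun u hu hu' => absurd hu hu', fun u _ => ?_, hsum.le,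
        fun τ hτ _ _ => ⟨hsum, fun u hu => ⟨ρ, by simp, ?_, ?_⟩⟩⟩
      · dsimp only
        split_ifs with h
        · exact mul_pos (hp u) hfac
        · exact hp u
      · split_ifs with h
        · exact mul_nonneg (hp u).le (div_nonneg hb hq0.le)
        · exact le_rfl
      · have : u ∉ P := fun h => by have := hPv u h; tauto
        simp [this]
      · have : u ∉ P := fun h => by have := hPv u h; tauto
        simp [this]
      · dsimp only
        split_ifs with h
        · ring
        · ring
      · by_cases h : u ∈ P
        · exact (hPv u h).2.1
        · simp [h] at hu
      · rcases List.mem_cons.mp hτ with rfl | h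
        · exact le_rfl
        · exact hρl τ h
    · push Not at hqb
      have hSP : S ∪ (A ∪ P) = (S ∪ A) ∪ path v ρ.node := by
        ext x; simp only [hP, Finset.mem_union, Finset.mem_sdiff]; tauto
      have hρmem : ρ.node ∈ S ∪ (A ∪ P) := by
        rw [hSP]; simp [mem_path, hρ]
      obtain ⟨h1, Y, hYv, hY⟩ := ih hl' hlv' (b - q) (sub_nonneg.mpr hqb) (A ∪ P)
        (fun x => if x ∈ P then c x else p x)
        (fun u => by split_ifs; exacts [hc u, hp u])
        (by rw [hSP]; exact isLowerSet_union_path hSA (by simp [hv]))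
      set F := fallLoop c v S l (b - q) (A ∪ P) (fun x => if x ∈ P then c x else p x) with hF
      have hYP : ∀ u ∈ P, Y u = 0 := fun u hu => hY.pay_old u (Or.inr (by simp [hu]))
      have hsum : ∑ u, (if u ∈ P then p u else Y u) = q + ∑ u, Y u := by
        have : ∀ u, (if u ∈ P then p u else Y u) = (if u ∈ P then p u else 0) + Y u := by
          intro u; split_ifs with h
          · simp [hYP u h]
          · simp
        simp only [this, Finset.sum_add_distrib, hq]
        simp
      refine ⟨h1, fun u => if u ∈ P then p u else Y u, fun u hu => ?_, ?_⟩
      · by_cases h : u ∈ P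
        · exact (hPv u h).1
        · exact hYv u (by simpa [h] using hu)
      refine ⟨Finset.subset_union_left.trans hY.subset, hY.price_pos, fun u => ?_, fun u hu => ?_,
        fun u hu => ?_, fun u hu huA => ?_, fun u hu huA => ?_, fun u hu => ?_, ?_,
        fun τ hτ hτS hτA => ?_⟩
      · split_ifs with h
        exacts [(hp u).le, hY.nonneg u]
      · have hn : u ∉ P := fun h => by have := hPv u h; tauto
        simp only [hn, if_false]
        exact hY.pay_old u (hu.imp_right fun h => by simp [h])
      · have hn : u ∉ P := fun h => by have := hPv u h; tauto
        rw [hY.price_old u (hu.imp_right fun h => by simp [h])]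
        simp [hn]
      · by_cases h : u ∈ P
        · simp [h]
        · have := hY.pay_added u hu (by simp [huA, h])
          simpa [h] using this
      · by_cases h : u ∈ P
        · rw [hY.price_old u (Or.inr (by simp [h]))]; simp [h]
        · exact hY.price_added u hu (by simp [huA, h])
      · have h : u ∉ P := fun h => hu (hY.subset (by simp [h]))
        have := hY.price_rest u hu
        simpa [h] using this
      · rw [hsum]; linarith [hY.sum_le]
      -- The head request has just been accepted, so `τ` is a later one.
      · have hτl : τ ∈ l := by
          rcases List.mem_cons.mp hτ with rfl | h
          · rcases Finset.mem_union.mp hρmem with h | h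
            · exact absurd h hτS
            · exact absurd (hY.subset h) hτA
          · exact h
        obtain ⟨h3, h4⟩ := hY.exhausted τ hτl hτS hτA
        refine ⟨by rw [hsum, h3]; ring, fun u hu => ?_⟩
        by_cases h : u ∈ P
        · exact ⟨ρ, by simp, (hPv u h).2.1, hρl τ hτl⟩
        · obtain ⟨σ, hσ, h5⟩ := h4 u (by simpa [h] using hu)
          exact ⟨σ, by simp [hσ], h5⟩

/-! ### The payments of a service -/

/-- While the nodes of `Q` and their successors in the queue are processed, the service tree grows
from `S` to `S'`, the prices change from `p` to `p'`, and the `v`-fall pays the amount `X v u` to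
the node `u`. -/
structure QueuePays [Fintype T] (c : T → ℝ) (pending : Finset (Request T)) (Q : Set T)
    (S : Finset T) (p : T → ℝ) (S' : Finset T) (p' : T → ℝ) (X : T → T → ℝ) : Prop where
  subset : S ⊆ S'
  lower : IsLowerSet (S' : Set T)
  price_pos : ∀ u, 0 < p' u
  nonneg : ∀ v u, 0 ≤ X v u
  payer : ∀ v ∈ S, v ∉ Q → ∀ u, X v u = 0
  payer_mem : ∀ v, v ∉ S' → ∀ u, X v u = 0
  lt : ∀ v u, X v u ≠ 0 → v < u
  pay_old : ∀ u ∈ S, ∀ v, X v u = 0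
  price_old : ∀ u ∈ S, p' u = p u
  pay_added : ∀ u ∈ S', u ∉ S → ∑ v, X v u = p u
  price_added : ∀ u ∈ S', u ∉ S → p' u = c u
  price_rest : ∀ u, u ∉ S' → p' u = p u - ∑ v, X v u
  sum_le : ∀ v, ∑ u, X v u ≤ c v
  -- The premise `v ∈ S → v ∈ Q` says that the `v`-fall is still to come.
  exhausted : ∀ v ∈ S', (v ∈ S → v ∈ Q) → ∀ τ ∈ pending, v ≤ τ.node → τ.node ∉ S' →
    ∑ u, X v u = c v ∧
    ∀ u, X v u ≠ 0 → ∃ σ ∈ pending, u ≤ σ.node ∧ σ.deadline ≤ τ.deadline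

theorem EnqueueRule.mem_toList (E : EnqueueRule T) {A : Finset T} {v : T} :
    v ∈ E.toList A ↔ v ∈ A := by
  rw [← Multiset.mem_coe, E.spec, Finset.mem_val]

theorem EnqueueRule.nodup_toList (E : EnqueueRule T) (A : Finset T) : (E.toList A).Nodup := by
  rw [← Multiset.coe_nodup, E.spec]
  exact A.nodup

/-- Every node is dequeued at most once, because a fall adds only nodes outside the current tree.
The row of `v` is therefore empty in the payments of the remaining loop, and the payments of the
`v`-fall can be written into it. -/
theorem exists_queuePays [Fintype T] {c : T → ℝ} (hc : ∀ v, 0 < c v) (E : EnqueueRule T)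
    (pending : Finset (Request T)) (Q : List T) (S : Finset T) (p : T → ℝ) (hp : ∀ u, 0 < p u)
    (hQ : Q.Nodup) (hQS : ∀ v ∈ Q, v ∈ S) (hS : IsLowerSet (S : Set T)) :
    ∃ X : T → T → ℝ, QueuePays c pending {v | v ∈ Q} S p (queueLoop c E pending Q S p).1
      (queueLoop c E pending Q S p).2 X := by
  classical
  induction Q, S, p using queueLoop.induct c E pending with
  | case1 S p =>
    rw [queueLoop]
    refine ⟨0, ?_⟩
    constructor <;> simp_all [(hc _).le]
  | case2 S p v Q ih =>
    rw [queueLoop]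
    have hvS : v ∈ S := hQS v (by simp)
    obtain ⟨hvQ, hQ'⟩ := List.nodup_cons.mp hQ
    obtain ⟨h1, Y, hYv, hY⟩ := exists_fallPays hc hvS
      (byDeadline (pending.filter fun ρ => v ≤ ρ.node)) (pairwise_byDeadline_le _)
      (fun ρ hρ => by simpa using (Finset.mem_filter.mp (mem_byDeadline.mp hρ)).2) (c v) (hc v).le
      ∅ p hp (by simpa using hS)
    have hdisj := fall_disjoint c pending v S p
    change FallPays c S _ (c v) ∅ p (fall c pending v S p).1 (fall c pending v S p).2 Y at hY
    change IsLowerSet ((S ∪ (fall c pending v S p).1 : Finset T) : Set T) at h1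
    obtain ⟨X, hX⟩ := ih hY.price_pos
      (by
        rw [List.nodup_append]
        refine ⟨hQ', E.nodup_toList _, fun a ha b hb hab => ?_⟩
        rw [E.mem_toList] at hb
        exact Finset.disjoint_left.mp hdisj (hQS a (by simp [ha])) (hab ▸ hb))
      (by
        intro w hw
        rw [List.mem_append, E.mem_toList] at hw
        rcases hw with hw | hw
        · exact Finset.mem_union_left _ (hQS w (by simp [hw]))
        · exact Finset.mem_union_right _ hw)
      h1
    set F := fall c pending v S p with hF
    set G := queueLoop c E pending (Q ++ E.toList F.1) (S ∪ F.1) F.2 with hG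
    have hmemQ : ∀ w, w ∈ {w | w ∈ Q ++ E.toList F.1} ↔ w ∈ Q ∨ w ∈ F.1 := by
      intro w; simp [E.mem_toList]
    have hvF : v ∉ F.1 := Finset.disjoint_left.mp hdisj hvS
    -- `v` is in the tree but no longer in the queue, so it pays nothing more.
    have hXv : ∀ u, X v u = 0 := hX.payer v (by simp [hvS]) (by rw [hmemQ]; tauto)
    have hcol : ∀ u, ∑ w, (if w = v then Y u else X w u) = Y u + ∑ w, X w u := by
      intro u
      have : ∀ w, (if w = v then Y u else X w u) = (if w = v then Y u else 0) + X w u := by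
        intro w; split_ifs with h
        · simp [h, hXv]
        · simp
      simp [this, Finset.sum_add_distrib]
    have hSF : S ∪ F.1 ⊆ G.1 := hX.subset
    refine ⟨fun w u => if w = v then Y u else X w u, ?_⟩
    refine ⟨Finset.subset_union_left.trans hSF, hX.lower, hX.price_pos, fun w u => ?_,
      fun w hw hwQ u => ?_, fun w hw u => ?_, fun w u hwu => ?_, fun u hu w => ?_, fun u hu => ?_,
      fun u hu huS => ?_, fun u hu huS => ?_, fun u hu => ?_, fun w => ?_,
      fun w hw hwQ τ hτ hwτ hτG => ?_⟩
    · split_ifs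
      exacts [hY.nonneg u, hX.nonneg w u]
    · simp only [Set.mem_ofPred_eq, List.mem_cons, not_or] at hwQ
      rw [if_neg hwQ.1]
      refine hX.payer w (by simp [hw]) ?_ u
      rw [hmemQ]
      exact fun h => h.elim hwQ.2 (Finset.disjoint_left.mp hdisj hw)
    · rw [if_neg (fun h => hw (hSF (by simp [h, hvS])))]
      exact hX.payer_mem w hw u
    · split_ifs at hwu with h
      · subst h
        refine lt_of_le_of_ne (hYv u hwu) fun h => hwu (hY.pay_old u (Or.inl (h ▸ hvS)))
      · exact hX.lt w u hwu
    · split_ifs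
      · exact hY.pay_old u (Or.inl hu)
      · exact hX.pay_old u (by simp [hu]) w
    · rw [hX.price_old u (by simp [hu]), hY.price_old u (Or.inl hu)]
    · rw [hcol]
      by_cases h : u ∈ F.1
      · rw [hY.pay_added u h (by simp)]
        simp [hX.pay_old u (by simp [h])]
      · rw [hX.pay_added u hu (by simp [huS, h]), hY.price_rest u h]; ring
    · by_cases h : u ∈ F.1
      · rw [hX.price_old u (by simp [h]), hY.price_added u h (by simp)]
      · exact hX.price_added u hu (by simp [huS, h])
    · have h : u ∉ F.1 := fun h => hu (hSF (by simp [h]))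
      rw [hX.price_rest u hu, hY.price_rest u h, hcol]; ring
    · by_cases h : w = v
      · subst h; simpa using hY.sum_le
      · simpa [h] using hX.sum_le w
    · by_cases h : w = v
      · subst h
        obtain ⟨h3, h4⟩ := hY.exhausted τ (by rw [mem_byDeadline]; simp [hτ, hwτ])
          (fun h => hτG (hSF (by simp [h]))) (fun h => hτG (hSF (by simp [h])))
        refine ⟨by simpa using h3, fun u hu => ?_⟩
        obtain ⟨σ, hσ, h5⟩ := h4 u (by simpa using hu)
        exact ⟨σ, (Finset.mem_filter.mp (mem_byDeadline.mp hσ)).1, h5⟩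
      · have := hX.exhausted w hw (by
          intro hwS
          rw [hmemQ]
          rcases Finset.mem_union.mp hwS with h' | h'
          · have := hwQ h'
            simp [h] at this
            exact Or.inl this
          · exact Or.inr h') τ hτ hwτ hτG
        simpa [h] using this

/-! ### Runs of Waterfall -/

/-- The requests that are pending when the service `s i` of the sequence `s` is built. -/
def pend (R : Finset (Request T)) (s : ℕ → Service T) (i : ℕ) : Finset (Request T) :=
  pendingAt R ((List.range i).map s) (s i).time

theorem mem_pend {R : Finset (Request T)} {s : ℕ → Service T} {i : ℕ} {σ : Request T} :
    σ ∈ pend R s i ↔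
      σ ∈ R ∧ σ.arrival ≤ (s i).time ∧ ∀ k < i, ¬ (s k).Satisfies σ := by
  classical
  simp [pend, pendingAt]

/-- The services `s i` with `i < n` are built one after the other, triggered by the requests
`due i`, where `p i` are the prices before the service `s i`, and `X i v u` is the amount that the
`v`-fall of this service pays to the node `u`. -/
structure IsTrace [Fintype T] (c : T → ℝ) (R : Finset (Request T)) (n : ℕ) (s : ℕ → Service T)
    (due : ℕ → Request T) (p : ℕ → T → ℝ) (X : ℕ → T → T → ℝ) : Prop where
  price_zero : p 0 = c
  price_pos : ∀ i ≤ n, ∀ u, 0 < p i u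
  time_lt : ∀ i j, i < j → j < n → (s i).time < (s j).time
  due_pending : ∀ i < n, due i ∈ pend R s i
  due_deadline : ∀ i < n, (due i).deadline = (s i).time
  pays : ∀ i < n, ∃ p' : T → ℝ, (∀ u ∈ path ⊥ (due i).node, p' u = c u) ∧
    (∀ u, u ∉ path ⊥ (due i).node → p' u = p i u) ∧
    QueuePays c (pend R s i) {v | v ∈ path ⊥ (due i).node} (path ⊥ (due i).node) p'
      (s i).nodes (p (i + 1)) (X i)

/-- Only the initial segments of the sequences matter; this allows a trace to be extended by
`Function.update`. -/
theorem IsTrace.congr [Fintype T] {c : T → ℝ} {R : Finset (Request T)} {n : ℕ}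
    {s s' : ℕ → Service T} {due due' : ℕ → Request T} {p p' : ℕ → T → ℝ} {X X' : ℕ → T → T → ℝ}
    (h : IsTrace c R n s due p X) (hs : ∀ i < n, s' i = s i) (hdue : ∀ i < n, due' i = due i)
    (hp : ∀ i ≤ n, p' i = p i) (hX : ∀ i < n, X' i = X i) : IsTrace c R n s' due' p' X' := by
  have hpend : ∀ i < n, pend R s' i = pend R s i := by
    intro i hi
    ext σ
    rw [mem_pend, mem_pend, hs i hi]
    refine and_congr_right fun _ => and_congr_right fun _ => forall₂_congr fun k hk => ?_
    rw [hs k (hk.trans hi)]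
  refine ⟨by rw [hp 0 (Nat.zero_le _), h.price_zero], fun i hi => ?_, fun i j hij hj => ?_,
    fun i hi => ?_, fun i hi => ?_, fun i hi => ?_⟩
  · rw [hp i hi]; exact h.price_pos i hi
  · rw [hs i (hij.trans hj), hs j hj]; exact h.time_lt i j hij hj
  · rw [hdue i hi, hpend i hi]; exact h.due_pending i hi
  · rw [hdue i hi, hs i hi]; exact h.due_deadline i hi
  · rw [hdue i hi, hpend i hi, hs i hi, hp i hi.le, hp (i + 1) hi, hX i hi]; exact h.pays i hi

/-- The state has been reached by a run with a trace. -/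
def HasTrace [Fintype T] (c : T → ℝ) (R : Finset (Request T)) (st : State T) : Prop :=
  ∃ n s due p X, IsTrace c R n s due p X ∧ st.sent = (List.range n).map s ∧ st.price = p n

theorem hasTrace_init [Fintype T] {c : T → ℝ} (hc : ∀ v, 0 < c v)
    (R : Finset (Request T)) : HasTrace c R ⟨c, []⟩ := by
  -- With no services, only the initial price carries information; the other values are dummies.
  refine ⟨0, fun _ => ⟨∅, 0⟩, fun _ => ⟨⊥, 0, 0⟩, fun _ => c, 0, ?_, by simp, rfl⟩
  constructor <;> simp_all

theorem isLowerSet_path_bot [Fintype T] (w : T) : IsLowerSet ((path ⊥ w : Finset T) : Set T) := by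
  intro a b hba ha
  simp only [Finset.mem_coe, mem_path, bot_le, true_and] at ha ⊢
  exact hba.trans ha

theorem HasTrace.step [Fintype T] {c : T → ℝ} (hc : ∀ v, 0 < c v) (E : EnqueueRule T)
    {R : Finset (Request T)} {st : State T} (h : HasTrace c R st) {ρ : Request T} (hρ : ρ ∈ R)
    (harr : ρ.arrival ≤ ρ.deadline) (htime : ∀ s ∈ st.sent, s.time < ρ.deadline) :
    HasTrace c R (waterfallStep c E R st ρ) := by
  classical
  rw [waterfallStep]
  split_ifs with hsat
  · exact h
  obtain ⟨n, s, due, p, X, htr, hsent, hprice⟩ := h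
  set P := path ⊥ ρ.node with hP
  set p₀ : T → ℝ := fun v => if v ∈ P then c v else st.price v with hp₀
  have hp₀pos : ∀ u, 0 < p₀ u := by
    intro u
    simp only [hp₀]
    split_ifs
    · exact hc u
    · rw [hprice]; exact htr.price_pos n le_rfl u
  obtain ⟨Y, hY⟩ := exists_queuePays hc E (pendingAt R st.sent ρ.deadline) (E.toList P) P p₀
    hp₀pos (E.nodup_toList P) (fun v hv => E.mem_toList.mp hv) (isLowerSet_path_bot ρ.node)
  simp only [E.mem_toList] at hY
  set G := queueLoop c E (pendingAt R st.sent ρ.deadline) (E.toList P) P p₀ with hG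
  have hs : ∀ i < n, Function.update s n ⟨G.1, ρ.deadline⟩ i = s i :=
    fun i hi => Function.update_of_ne hi.ne _ _
  have hpre : (List.range n).map (Function.update s n ⟨G.1, ρ.deadline⟩) = st.sent := by
    rw [hsent]
    exact List.map_congr_left fun i hi => hs i (List.mem_range.mp hi)
  have hpn : pend R (Function.update s n ⟨G.1, ρ.deadline⟩) n = pendingAt R st.sent ρ.deadline := by
    rw [pend, hpre]; simp
  have htr' : IsTrace c R n (Function.update s n ⟨G.1, ρ.deadline⟩) (Function.update due n ρ)
      (Function.update p (n + 1) G.2) (Function.update X n Y) :=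
    htr.congr hs (fun i hi => Function.update_of_ne hi.ne _ _)
      (fun i hi => Function.update_of_ne (by omega) _ _)
      (fun i hi => Function.update_of_ne hi.ne _ _)
  -- Prices are updated at `n + 1`, not `n`: `p n` holds the prices before the new service.
  refine ⟨n + 1, Function.update s n ⟨G.1, ρ.deadline⟩, Function.update due n ρ,
    Function.update p (n + 1) G.2, Function.update X n Y, ?_, ?_, by simp [hG, hp₀]⟩
  · refine ⟨htr'.price_zero, fun i hi => ?_, fun i j hij hj => ?_, fun i hi => ?_, fun i hi => ?_,
      fun i hi => ?_⟩
    · rcases Nat.le_succ_iff.mp hi with hi | rfl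
      · exact htr'.price_pos i hi
      · simpa using hY.price_pos
    · rcases Nat.lt_succ_iff_lt_or_eq.mp hj with hj | rfl
      · exact htr'.time_lt i j hij hj
      · rw [hs i hij, Function.update_self]
        exact htime _ (by rw [hsent]; exact List.mem_map.mpr ⟨i, List.mem_range.mpr hij, rfl⟩)
    · rcases Nat.lt_succ_iff_lt_or_eq.mp hi with hi | rfl
      · exact htr'.due_pending i hi
      · rw [hpn, Function.update_self]
        exact Finset.mem_filter.mpr ⟨hρ, harr, hsat⟩
    · rcases Nat.lt_succ_iff_lt_or_eq.mp hi with hi | rfl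
      · exact htr'.due_deadline i hi
      · simp
    · rcases Nat.lt_succ_iff_lt_or_eq.mp hi with hi | rfl
      · exact htr'.pays i hi
      · refine ⟨p₀, fun u hu => ?_, fun u hu => ?_, ?_⟩
        · simp only [Function.update_self] at hu; simp [hp₀, hP, hu]
        · simp only [Function.update_self] at hu; simp [hp₀, hP, hu, hprice]
        · rw [hpn]; simpa using hY
  · rw [List.range_succ, List.map_append, hpre]
    simp [hG, hp₀]

theorem waterfallStep_sent [Fintype T] (c : T → ℝ) (E : EnqueueRule T) (R : Finset (Request T))
    (st : State T) (ρ : Request T) : ∃ l : List (Service T),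
      (waterfallStep c E R st ρ).sent = st.sent ++ l ∧ ∀ s ∈ l, s.time = ρ.deadline := by
  classical
  rw [waterfallStep]
  split_ifs with h
  · exact ⟨[], by simp⟩
  · exact ⟨_, rfl, by simp⟩

theorem foldl_waterfallStep_sent [Fintype T] (c : T → ℝ) (E : EnqueueRule T)
    (R : Finset (Request T)) (l : List (Request T)) (st : State T) : ∃ m : List (Service T),
      (l.foldl (waterfallStep c E R) st).sent = st.sent ++ m ∧
        ∀ s ∈ m, ∃ ρ ∈ l, s.time = ρ.deadline := by
  induction l generalizing st with
  | nil => exact ⟨[], by simp⟩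
  | cons ρ l ih =>
    obtain ⟨m₁, h₁, h₁'⟩ := waterfallStep_sent c E R st ρ
    obtain ⟨m₂, h₂, h₂'⟩ := ih (waterfallStep c E R st ρ)
    refine ⟨m₁ ++ m₂, by rw [List.foldl_cons, h₂, h₁, List.append_assoc], fun s hs => ?_⟩
    rcases List.mem_append.mp hs with hs | hs
    · exact ⟨ρ, by simp, h₁' s hs⟩
    · obtain ⟨σ, hσ, h⟩ := h₂' s hs
      exact ⟨σ, by simp [hσ], h⟩

theorem HasTrace.satisfies_step [Fintype T] {c : T → ℝ} (hc : ∀ v, 0 < c v) (E : EnqueueRule T)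
    {R : Finset (Request T)} {st : State T} (h : HasTrace c R st) {ρ : Request T}
    (harr : ρ.arrival ≤ ρ.deadline) :
    ∃ s ∈ (waterfallStep c E R st ρ).sent, s.Satisfies ρ := by
  classical
  rw [waterfallStep]
  split_ifs with hsat
  · exact hsat
  obtain ⟨n, s, due, p, X, htr, hsent, hprice⟩ := h
  obtain ⟨Y, hY⟩ := exists_queuePays hc E (pendingAt R st.sent ρ.deadline)
    (E.toList (path ⊥ ρ.node)) (path ⊥ ρ.node)
    (fun v => if v ∈ path ⊥ ρ.node then c v else st.price v)
    (fun u => by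
      split_ifs
      · exact hc u
      · rw [hprice]; exact htr.price_pos n le_rfl u)
    (E.nodup_toList _) (fun v hv => E.mem_toList.mp hv) (isLowerSet_path_bot ρ.node)
  refine ⟨_, List.mem_append_right _ (List.mem_singleton_self _), ?_, harr, le_rfl⟩
  exact hY.subset (mem_path.mpr ⟨bot_le, le_rfl⟩)

theorem HasTrace.foldl [Fintype T] {c : T → ℝ} (hc : ∀ v, 0 < c v) (E : EnqueueRule T)
    {R : Finset (Request T)} (hR : IsInstance R) (l : List (Request T))
    (hl : l.Pairwise fun ρ σ => ρ.deadline < σ.deadline) (hlR : ∀ ρ ∈ l, ρ ∈ R)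
    (st : State T) (h : HasTrace c R st) (htime : ∀ s ∈ st.sent, ∀ ρ ∈ l, s.time < ρ.deadline) :
    HasTrace c R (l.foldl (waterfallStep c E R) st) ∧
      ∀ ρ ∈ l, ∃ s ∈ (l.foldl (waterfallStep c E R) st).sent, s.Satisfies ρ := by
  induction l generalizing st with
  | nil => simpa using h
  | cons ρ l ih =>
    obtain ⟨hρl, hl'⟩ := List.pairwise_cons.mp hl
    have hρ : ρ ∈ R := hlR ρ (by simp)
    obtain ⟨m, hm, hm'⟩ := waterfallStep_sent c E R st ρ
    obtain ⟨h1, h2⟩ := ih hl' (fun σ hσ => hlR σ (by simp [hσ])) (waterfallStep c E R st ρ)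
      (h.step hc E hρ (hR.1 ρ hρ) fun s hs => htime s hs ρ (by simp))
      (by
        intro s hs σ hσ
        rw [hm] at hs
        rcases List.mem_append.mp hs with hs | hs
        · exact htime s hs σ (by simp [hσ])
        · rw [hm' s hs]; exact hρl σ hσ)
    refine ⟨h1, fun σ hσ => ?_⟩
    rcases List.mem_cons.mp hσ with rfl | hσ
    · obtain ⟨s, hs, hsσ⟩ := h.satisfies_step hc E (hR.1 σ hρ)
      obtain ⟨m', hm', -⟩ := foldl_waterfallStep_sent c E R l (waterfallStep c E R st σ)
      exact ⟨s, by rw [List.foldl_cons, hm']; simp [hs], hsσ⟩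
    · exact h2 σ hσ

theorem exists_trace_waterfall [Fintype T] {c : T → ℝ} (hc : ∀ v, 0 < c v) (E : EnqueueRule T)
    {R : Finset (Request T)} (hR : IsInstance R) :
    ∃ n s due p X, IsTrace c R n s due p X ∧ waterfall c E R = (List.range n).map s ∧
      ∀ ρ ∈ R, ∃ i < n, (s i).Satisfies ρ := by
  obtain ⟨⟨n, s, due, p, X, h, hsent, -⟩, h2⟩ := HasTrace.foldl hc E hR (byDeadline R)
    (pairwise_byDeadline_lt hR) (fun ρ hρ => mem_byDeadline.mp hρ) _ (hasTrace_init hc R) (by simp)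
  refine ⟨n, s, due, p, X, h, hsent, fun ρ hρ => ?_⟩
  obtain ⟨t, ht, htρ⟩ := h2 ρ (mem_byDeadline.mpr hρ)
  rw [hsent, List.mem_map] at ht
  obtain ⟨i, hi, rfl⟩ := ht
  exact ⟨i, List.mem_range.mp hi, htρ⟩

/-! ### Waterfall is online -/

-- Distinct deadlines make the sorted list unique, so it may be cut at time `t`.
open Classical in
theorem byDeadline_eq_append {R : Finset (Request T)} (hR : IsInstance R) (t : ℝ) :
    byDeadline R = byDeadline (R.filter fun ρ => ρ.deadline ≤ t) ++
      byDeadline (R.filter fun ρ => ¬ ρ.deadline ≤ t) := by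
  have hpw : (byDeadline (R.filter fun ρ => ρ.deadline ≤ t) ++
      byDeadline (R.filter fun ρ => ¬ ρ.deadline ≤ t)).Pairwise
        fun ρ σ => ρ.deadline ≤ σ.deadline := by
    refine List.pairwise_append.mpr ⟨pairwise_byDeadline_le _, pairwise_byDeadline_le _, ?_⟩
    intro ρ hρ σ hσ
    rw [mem_byDeadline, Finset.mem_filter] at hρ hσ
    exact hρ.2.trans (not_le.mp hσ.2).le
  refine List.Perm.eq_of_pairwise (le := fun ρ σ : Request T => ρ.deadline ≤ σ.deadline) ?_
    (pairwise_byDeadline_le R) hpw ?_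
  · intro ρ σ hρ hσ h1 h2
    rw [mem_byDeadline] at hρ
    rw [List.mem_append, mem_byDeadline, mem_byDeadline, Finset.mem_filter,
      Finset.mem_filter] at hσ
    exact hR.2 ρ hρ σ (hσ.elim And.left And.left) (le_antisymm h1 h2)
  · refine (List.perm_ext_iff_of_nodup (nodup_byDeadline R) ?_).mpr fun ρ => ?_
    · refine List.nodup_append.mpr ⟨nodup_byDeadline _, nodup_byDeadline _, ?_⟩
      rintro ρ hρ σ hσ rfl
      rw [mem_byDeadline, Finset.mem_filter] at hρ hσ
      exact hσ.2 hρ.2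
    · rw [List.mem_append, mem_byDeadline, mem_byDeadline, mem_byDeadline, Finset.mem_filter,
        Finset.mem_filter]
      tauto

open Classical in
theorem pendingAt_congr {R R' : Finset (Request T)} {t d : ℝ} (hd : d ≤ t)
    (h : R.filter (fun ρ => ρ.arrival ≤ t) = R'.filter (fun ρ => ρ.arrival ≤ t))
    (sent : List (Service T)) : pendingAt R sent d = pendingAt R' sent d := by
  have key : ∀ Q : Finset (Request T),
      pendingAt Q sent d = pendingAt (Q.filter fun ρ => ρ.arrival ≤ t) sent d := by
    intro Q
    ext σ
    simp only [pendingAt, Finset.mem_filter]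
    constructor
    · rintro ⟨h1, h2, h3⟩
      exact ⟨⟨h1, h2.trans hd⟩, h2, h3⟩
    · rintro ⟨⟨h1, -⟩, h2, h3⟩
      exact ⟨h1, h2, h3⟩
  rw [key R, key R', h]

open Classical in
theorem foldl_waterfallStep_congr [Fintype T] (c : T → ℝ) (E : EnqueueRule T)
    {R R' : Finset (Request T)} {t : ℝ}
    (h : R.filter (fun ρ => ρ.arrival ≤ t) = R'.filter (fun ρ => ρ.arrival ≤ t))
    (l : List (Request T)) (hl : ∀ ρ ∈ l, ρ.deadline ≤ t) (st : State T) :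
    l.foldl (waterfallStep c E R) st = l.foldl (waterfallStep c E R') st := by
  induction l generalizing st with
  | nil => rfl
  | cons ρ l ih =>
    have : waterfallStep c E R st ρ = waterfallStep c E R' st ρ := by
      simp only [waterfallStep, pendingAt_congr (hl ρ (by simp)) h]
    rw [List.foldl_cons, List.foldl_cons, this]
    exact ih (fun σ hσ => hl σ (by simp [hσ])) _

-- Services are sent only at deadlines of the handled requests, so cutting the output at `t` amounts
-- to stopping the run at `t`.
open Classical in
theorem filter_waterfall [Fintype T] (c : T → ℝ) (E : EnqueueRule T) {R : Finset (Request T)}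
    (hR : IsInstance R) (t : ℝ) : (waterfall c E R).filter (fun s => s.time ≤ t) =
      ((byDeadline (R.filter fun ρ => ρ.deadline ≤ t)).foldl (waterfallStep c E R) ⟨c, []⟩).sent := by
  rw [waterfall, byDeadline_eq_append hR t, List.foldl_append]
  set st := (byDeadline (R.filter fun ρ => ρ.deadline ≤ t)).foldl (waterfallStep c E R) ⟨c, []⟩
    with hst
  obtain ⟨m, hm, hm'⟩ := foldl_waterfallStep_sent c E R
    (byDeadline (R.filter fun ρ => ¬ ρ.deadline ≤ t)) st
  obtain ⟨m₀, hm₀, hm₀'⟩ := foldl_waterfallStep_sent c E R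
    (byDeadline (R.filter fun ρ => ρ.deadline ≤ t)) ⟨c, []⟩
  rw [hm, List.filter_append]
  have h1 : st.sent.filter (fun s => s.time ≤ t) = st.sent := by
    refine List.filter_eq_self.mpr fun s hs => ?_
    rw [hst, hm₀, List.nil_append] at hs
    obtain ⟨ρ, hρ, hs'⟩ := hm₀' s hs
    rw [mem_byDeadline, Finset.mem_filter] at hρ
    simpa [hs'] using hρ.2
  have h2 : m.filter (fun s => s.time ≤ t) = [] := by
    refine List.filter_eq_nil_iff.mpr fun s hs => ?_
    obtain ⟨ρ, hρ, hs'⟩ := hm' s hs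
    rw [mem_byDeadline, Finset.mem_filter] at hρ
    simpa [hs'] using hρ.2
  rw [h1, h2, List.append_nil]

theorem isOnline_waterfall [Fintype T] (c : T → ℝ) (E : EnqueueRule T) :
    IsOnline (waterfall c E) := by
  classical
  intro R R' hR hR' t h
  -- A request due by `t` has arrived by `t`, so the deadlines handled up to `t` are determined by
  -- the arrivals.
  have key : ∀ Q : Finset (Request T), IsInstance Q → Q.filter (fun ρ => ρ.deadline ≤ t) =
      (Q.filter fun ρ => ρ.arrival ≤ t).filter fun ρ => ρ.deadline ≤ t := by
    intro Q hQ
    ext σ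
    simp only [Finset.mem_filter]
    exact ⟨fun hσ => ⟨⟨hσ.1, (hQ.1 σ hσ.1).trans hσ.2⟩, hσ.2⟩, fun hσ => ⟨hσ.1.1, hσ.2⟩⟩
  have hpre : R.filter (fun ρ => ρ.deadline ≤ t) = R'.filter (fun ρ => ρ.deadline ≤ t) := by
    rw [key R hR, key R' hR']
    convert congrArg (Finset.filter fun ρ : Request T => ρ.deadline ≤ t) h
  have h1 := filter_waterfall c E hR t
  have h2 := filter_waterfall c E hR' t
  rw [foldl_waterfallStep_congr c E (by convert h) _ fun ρ hρ =>
    (Finset.mem_filter.mp (mem_byDeadline.mp hρ)).2, hpre, ← h2] at h1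
  convert h1

/-! ### Charging -/

open Classical in
/-- Every element `e` has the cost `c e` and the level `L e`, and pays `x e f` to elements `f` of
higher level. Elements that are not late receive their full cost; late elements that are not
critical spend their full cost on late elements. Then the critical elements account for the
total cost up to the factor `D`. -/
theorem sum_le_mul_sum_critical {ι : Type*} (E : Finset ι) (late crit : ι → Prop)
    (hcrit : ∀ e, crit e → late e) (c L : ι → ℝ) (D : ℝ) (x : ι → ι → ℝ)
    (hx : ∀ e ∈ E, ∀ f ∈ E, 0 ≤ x e f)
    (hlevel : ∀ e ∈ E, ∀ f ∈ E, x e f ≠ 0 → L e + 1 ≤ L f)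
    (hLD : ∀ e ∈ E, L e ≤ D) (hL : ∀ e ∈ E, 1 ≤ L e)
    (hin : ∀ f ∈ E, ∑ e ∈ E, x e f ≤ c f)
    (hin_eq : ∀ f ∈ E, ¬ late f → ∑ e ∈ E, x e f = c f)
    (hout : ∀ e ∈ E, ∑ f ∈ E, x e f ≤ c e)
    (hout_eq : ∀ e ∈ E, late e → ¬ crit e → ∑ f ∈ E, x e f = c e)
    (hover : ∀ e ∈ E, late e → ¬ crit e → ∀ f ∈ E, x e f ≠ 0 → late f) :
    ∑ e ∈ E, c e ≤ D * ∑ e ∈ E.filter crit, c e := by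
  -- Indicators of the three classes: not late, critical, and late but not critical.
  set n : ι → ℝ := fun e => if late e then 0 else 1 with hn
  set k : ι → ℝ := fun e => if crit e then 1 else 0 with hk
  set o : ι → ℝ := fun e => if late e ∧ ¬ crit e then 1 else 0 with ho
  have hnko : ∀ e, n e + k e + o e = 1 := by
    intro e
    by_cases h1 : late e <;> by_cases h2 : crit e <;> simp [hn, hk, ho, h1, h2]
    exact h1 (hcrit e h2)
  have hn0 : ∀ e, 0 ≤ n e := fun e => by simp only [hn]; split_ifs <;> norm_num
  have hk0 : ∀ e, 0 ≤ k e := fun e => by simp only [hk]; split_ifs <;> norm_num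
  have ho0 : ∀ e, 0 ≤ o e := fun e => by simp only [ho]; split_ifs <;> norm_num
  -- Payments raise the level by at least one, so the weight `D - L f + 1` of the receiver is at
  -- most `D - L e`. After cancellation this says `∑ n c ≤ ∑ k (D - L) c`.
  have up : ∑ f ∈ E, n f * (D - L f + 1) * c f ≤ ∑ e ∈ E, (n e + k e) * (D - L e) * c e := by
    calc ∑ f ∈ E, n f * (D - L f + 1) * c f
        = ∑ f ∈ E, ∑ e ∈ E, n f * (D - L f + 1) * x e f := by
          refine Finset.sum_congr rfl fun f hf => ?_
          rw [← Finset.mul_sum]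
          by_cases h : late f
          · simp [hn, h]
          · rw [hin_eq f hf h]
      _ = ∑ e ∈ E, ∑ f ∈ E, n f * (D - L f + 1) * x e f := Finset.sum_comm
      _ ≤ ∑ e ∈ E, ∑ f ∈ E, (n e + k e) * (D - L e) * x e f := by
          refine Finset.sum_le_sum fun e he => Finset.sum_le_sum fun f hf => ?_
          have hr : 0 ≤ (n e + k e) * (D - L e) * x e f :=
            mul_nonneg (mul_nonneg (add_nonneg (hn0 e) (hk0 e)) (sub_nonneg.mpr (hLD e he)))
              (hx e he f hf)
          by_cases h0 : x e f = 0
          · simp [h0]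
          by_cases hf' : late f
          · simpa [hn, hf'] using hr
          have ho' : o e = 0 := by
            by_contra h
            have h' : late e ∧ ¬ crit e := by
              by_contra h'
              exact h (by simp [ho, h'])
            exact hf' (hover e he h'.1 h'.2 f hf h0)
          have h1 : n e + k e = 1 := by linarith [hnko e]
          have h2 : n f = 1 := by simp [hn, hf']
          rw [h1, h2]
          exact mul_le_mul_of_nonneg_right (by linarith [hlevel e he f hf h0]) (hx e he f hf)
      _ ≤ ∑ e ∈ E, (n e + k e) * (D - L e) * c e := by
          refine Finset.sum_le_sum fun e he => ?_
          rw [← Finset.mul_sum]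
          exact mul_le_mul_of_nonneg_left (hout e he)
            (mul_nonneg (add_nonneg (hn0 e) (hk0 e)) (sub_nonneg.mpr (hLD e he)))
  -- The mirror image, following outgoing payments with weight `L`: after cancellation, `∑ o c ≤ ∑ k
  -- (L - 1) c`.
  have down : ∑ e ∈ E, o e * L e * c e ≤ ∑ f ∈ E, (o f + k f) * (L f - 1) * c f := by
    calc ∑ e ∈ E, o e * L e * c e
        = ∑ e ∈ E, ∑ f ∈ E, o e * L e * x e f := by
          refine Finset.sum_congr rfl fun e he => ?_
          rw [← Finset.mul_sum]
          by_cases h : late e ∧ ¬ crit e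
          · rw [hout_eq e he h.1 h.2]
          · simp [ho, h]
      _ ≤ ∑ e ∈ E, ∑ f ∈ E, (o f + k f) * (L f - 1) * x e f := by
          refine Finset.sum_le_sum fun e he => Finset.sum_le_sum fun f hf => ?_
          have hr : 0 ≤ (o f + k f) * (L f - 1) * x e f :=
            mul_nonneg (mul_nonneg (add_nonneg (ho0 f) (hk0 f)) (sub_nonneg.mpr (hL f hf)))
              (hx e he f hf)
          by_cases h0 : x e f = 0
          · simp [h0]
          by_cases he' : late e ∧ ¬ crit e
          · have h1 : n f = 0 := by simp [hn, hover e he he'.1 he'.2 f hf h0]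
            have h2 : o f + k f = 1 := by linarith [hnko f]
            have h3 : o e = 1 := by simp only [ho, if_pos he']
            rw [h2, h3]
            exact mul_le_mul_of_nonneg_right (by linarith [hlevel e he f hf h0]) (hx e he f hf)
          · simpa only [ho, if_neg he', zero_mul] using hr
      _ = ∑ f ∈ E, ∑ e ∈ E, (o f + k f) * (L f - 1) * x e f := Finset.sum_comm
      _ ≤ ∑ f ∈ E, (o f + k f) * (L f - 1) * c f := by
          refine Finset.sum_le_sum fun f hf => ?_
          rw [← Finset.mul_sum]
          exact mul_le_mul_of_nonneg_left (hin f hf)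
            (mul_nonneg (add_nonneg (ho0 f) (hk0 f)) (sub_nonneg.mpr (hL f hf)))
  have hright : D * ∑ e ∈ E.filter crit, c e = ∑ e ∈ E, D * k e * c e := by
    rw [Finset.sum_filter, Finset.mul_sum]
    refine Finset.sum_congr rfl fun e _ => ?_
    simp only [hk]
    split_ifs <;> ring
  have hid : ∑ e ∈ E, D * k e * c e - ∑ e ∈ E, c e =
      (∑ e ∈ E, (n e + k e) * (D - L e) * c e - ∑ f ∈ E, n f * (D - L f + 1) * c f) +
      (∑ f ∈ E, (o f + k f) * (L f - 1) * c f - ∑ e ∈ E, o e * L e * c e) := by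
    rw [← Finset.sum_sub_distrib, ← Finset.sum_sub_distrib, ← Finset.sum_sub_distrib,
      ← Finset.sum_add_distrib]
    refine Finset.sum_congr rfl fun e _ => ?_
    have : o e = 1 - n e - k e := by linarith [hnko e]
    rw [this]
    ring
  rw [hright]
  linarith

/-! ### Levels -/

theorem level_lt_level [Fintype T] {v w : T} (h : v < w) : level v < level w := by
  classical
  refine Finset.card_lt_card ⟨fun x hx => ?_, fun hsub => ?_⟩
  · simp only [Finset.mem_filter, Finset.mem_univ, true_and] at hx ⊢
    exact hx.trans h.le
  · have := @hsub w (by simp)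
    simp only [Finset.mem_filter, Finset.mem_univ, true_and] at this
    exact h.not_ge this

theorem level_le_depth [Fintype T] (v : T) : level v ≤ depth T :=
  Finset.le_sup (f := fun v : T => level v) (Finset.mem_univ v)

theorem one_le_level [Fintype T] (v : T) : 1 ≤ level v := by
  classical
  exact Finset.card_pos.mpr ⟨v, by simp⟩

/-! ### Payments of a run -/

/-- The service `s j` is the first one from `s i` on that contains `u`. -/
def IsNext (s : ℕ → Service T) (u : T) (i j : ℕ) : Prop :=
  i ≤ j ∧ u ∈ (s j).nodes ∧ ∀ k, i ≤ k → k < j → u ∉ (s k).nodes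

theorem IsNext.unique {s : ℕ → Service T} {u : T} {i j k : ℕ} (hj : IsNext s u i j)
    (hk : IsNext s u i k) : j = k := by
  rcases lt_trichotomy j k with h | h | h
  · exact absurd hj.2.1 (hk.2.2 j hj.1 h)
  · exact h
  · exact absurd hk.2.1 (hj.2.2 k hk.1 h)

theorem exists_isNext {s : ℕ → Service T} {u : T} {i k : ℕ} (hik : i ≤ k)
    (hk : u ∈ (s k).nodes) : ∃ j ≤ k, IsNext s u i j := by
  classical
  have hex : ∃ j, i ≤ j ∧ u ∈ (s j).nodes := ⟨k, hik, hk⟩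
  refine ⟨Nat.find hex, Nat.find_min' hex ⟨hik, hk⟩, (Nat.find_spec hex).1, (Nat.find_spec hex).2,
    fun l hil hl hul => Nat.find_min hex hl ⟨hil, hul⟩⟩

open Classical in
theorem sum_ite_isNext_of_exists {s : ℕ → Service T} {u : T} {i j n : ℕ} (hj : j < n)
    (h : IsNext s u i j) (a : ℝ) :
    ∑ k ∈ Finset.range n, (if IsNext s u i k then a else 0) = a := by
  rw [Finset.sum_eq_single_of_mem j (Finset.mem_range.mpr hj), if_pos h]
  intro k _ hkj
  rw [if_neg fun hk => hkj (hk.unique h)]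

open Classical in
theorem sum_ite_isNext_le (s : ℕ → Service T) (u : T) (i n : ℕ) {a : ℝ} (ha : 0 ≤ a) :
    ∑ k ∈ Finset.range n, (if IsNext s u i k then a else 0) ≤ a := by
  by_cases h : ∃ j < n, IsNext s u i j
  · obtain ⟨j, hj, h⟩ := h
    exact (sum_ite_isNext_of_exists hj h a).le
  · rw [Finset.sum_eq_zero]
    · exact ha
    · intro k hk
      rw [if_neg fun hk' => h ⟨k, Finset.mem_range.mp hk, hk'⟩]

section Trace

variable [Fintype T] {c : T → ℝ} {R : Finset (Request T)} {n : ℕ} {s : ℕ → Service T}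
  {due : ℕ → Request T} {p : ℕ → T → ℝ} {X : ℕ → T → T → ℝ}

theorem IsTrace.time_mono (h : IsTrace c R n s due p X) {i j : ℕ} (hij : i ≤ j) (hj : j < n) :
    (s i).time ≤ (s j).time := by
  rcases hij.lt_or_eq with hij | rfl
  exacts [(h.time_lt i j hij hj).le, le_rfl]

theorem IsTrace.lower (h : IsTrace c R n s due p X) {i : ℕ} (hi : i < n) :
    IsLowerSet ((s i).nodes : Set T) := by
  obtain ⟨p', -, -, hX⟩ := h.pays i hi
  exact hX.lower

theorem IsTrace.nonneg (h : IsTrace c R n s due p X) {i : ℕ} (hi : i < n) (v u : T) :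
    0 ≤ X i v u := by
  obtain ⟨p', -, -, hX⟩ := h.pays i hi
  exact hX.nonneg v u

theorem IsTrace.isValid (h : IsTrace c R n s due p X) {i : ℕ} (hi : i < n) : (s i).IsValid := by
  obtain ⟨p', -, -, hX⟩ := h.pays i hi
  exact ⟨hX.subset (mem_path.mpr ⟨le_rfl, bot_le⟩), hX.lower⟩

theorem IsTrace.price_of_mem (h : IsTrace c R n s due p X) {i : ℕ} (hi : i < n) {u : T}
    (hu : u ∈ (s i).nodes) : p (i + 1) u = c u := by
  obtain ⟨p', hp', -, hX⟩ := h.pays i hi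
  by_cases hd : u ∈ path ⊥ (due i).node
  · rw [hX.price_old u hd, hp' u hd]
  · exact hX.price_added u hu hd

theorem IsTrace.price_of_notMem (h : IsTrace c R n s due p X) {i : ℕ} (hi : i < n) {u : T}
    (hu : u ∉ (s i).nodes) : p (i + 1) u = p i u - ∑ v, X i v u := by
  obtain ⟨p', -, hp', hX⟩ := h.pays i hi
  rw [hX.price_rest u hu, hp' u fun hd => hu (hX.subset hd)]

-- The ledger of `u`: its price falls short of `c u` by what it was paid since its last service. A
-- service containing `u` resets the price and empties the sum.
open Classical in
theorem IsTrace.price_add_sum (h : IsTrace c R n s due p X) (u : T) {m : ℕ} (hm : m ≤ n) :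
    p m u + ∑ i ∈ Finset.range m,
      (if ∀ k, i ≤ k → k < m → u ∉ (s k).nodes then ∑ v, X i v u else 0) = c u := by
  induction m with
  | zero => simp [h.price_zero]
  | succ m ih =>
    have hmn : m < n := hm
    by_cases hu : u ∈ (s m).nodes
    · rw [h.price_of_mem hmn hu, Finset.sum_eq_zero, add_zero]
      intro i hi
      rw [if_neg]
      exact fun hall => hall m (Nat.lt_succ_iff.mp (Finset.mem_range.mp hi)) m.lt_succ_self hu
    · have hiff : ∀ i, i ≤ m → ((∀ k, i ≤ k → k < m + 1 → u ∉ (s k).nodes) ↔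
          ∀ k, i ≤ k → k < m → u ∉ (s k).nodes) := by
        refine fun i _ => ⟨fun hall k h1 h2 => hall k h1 (h2.trans m.lt_succ_self),
          fun hall k h1 h2 => ?_⟩
        rcases Nat.lt_succ_iff_lt_or_eq.mp h2 with h2 | rfl
        exacts [hall k h1 h2, hu]
      rw [Finset.sum_range_succ, h.price_of_notMem hmn hu]
      have hlast : ∀ k, m ≤ k → k < m + 1 → u ∉ (s k).nodes :=
        (hiff m le_rfl).mpr fun k h1 h2 => absurd h2 (not_lt.mpr h1)
      rw [if_pos hlast, Finset.sum_congr rfl fun i hi =>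
        if_congr (hiff i (Finset.mem_range.mp hi).le) rfl rfl]
      linarith [ih hmn.le]

-- Payments made before service `j` make up the discount `c u - p j u`; those made within it count
-- too, since `IsNext` allows `i = j`.
open Classical in
theorem IsTrace.received (h : IsTrace c R n s due p X) {j : ℕ} (hj : j < n) {u : T}
    (hu : u ∈ (s j).nodes) :
    ∑ i ∈ Finset.range n, ∑ v, (if IsNext s u i j then X i v u else 0) =
      c u - p j u + ∑ v, X j v u := by
  have hsub : Finset.range (j + 1) ⊆ Finset.range n := Finset.range_subset_range.mpr hj
  rw [← Finset.sum_subset hsub]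
  · rw [Finset.sum_range_succ, ← h.price_add_sum u hj.le]
    have hlast : IsNext s u j j := ⟨le_rfl, hu, fun k h1 h2 => absurd h2 (not_lt.mpr h1)⟩
    have hterm : ∀ i ∈ Finset.range j, ∑ v, (if IsNext s u i j then X i v u else 0) =
        if ∀ k, i ≤ k → k < j → u ∉ (s k).nodes then ∑ v, X i v u else 0 := by
      intro i hi
      have hiff : IsNext s u i j ↔ ∀ k, i ≤ k → k < j → u ∉ (s k).nodes :=
        ⟨fun hn => hn.2.2, fun hn => ⟨(Finset.mem_range.mp hi).le, hu, hn⟩⟩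
      simp only [hiff]
      split_ifs
      · rfl
      · simp
    rw [Finset.sum_congr rfl hterm]
    simp only [if_pos hlast]
    ring
  · intro i _ hi
    refine Finset.sum_eq_zero fun v _ => if_neg fun hn => hi ?_
    exact Finset.mem_range.mpr (Nat.lt_succ_of_le hn.1)

open Classical in
theorem IsTrace.received_le (h : IsTrace c R n s due p X) {j : ℕ} (hj : j < n) {u : T}
    (hu : u ∈ (s j).nodes) :
    ∑ i ∈ Finset.range n, ∑ v, (if IsNext s u i j then X i v u else 0) ≤ c u := by
  rw [h.received hj hu]
  obtain ⟨p', -, hp', hX⟩ := h.pays j hj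
  by_cases hd : u ∈ path ⊥ (due j).node
  · simp only [hX.pay_old u hd, Finset.sum_const_zero]
    linarith [h.price_pos j hj.le u]
  · rw [hX.pay_added u hu hd, hp' u hd]
    linarith

-- Off the triggering path, a node enters the tree only when a fall pays its remaining price.
open Classical in
theorem IsTrace.received_eq (h : IsTrace c R n s due p X) {j : ℕ} (hj : j < n) {u : T}
    (hu : u ∈ (s j).nodes) (hd : u ∉ path ⊥ (due j).node) :
    ∑ i ∈ Finset.range n, ∑ v, (if IsNext s u i j then X i v u else 0) = c u := by
  rw [h.received hj hu]
  obtain ⟨p', -, hp', hX⟩ := h.pays j hj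
  rw [hX.pay_added u hu hd, hp' u hd]
  ring

/-! ### Overdue and critical nodes -/

/-- At the service `s i`, some request below `v` is pending that is due before the next service of
`O` to `v`. -/
def Overdue (R : Finset (Request T)) (s : ℕ → Service T) (O : List (Service T)) (i : ℕ) (v : T) :
    Prop :=
  ∃ σ ∈ pend R s i, v ≤ σ.node ∧
    ∀ o ∈ O, v ∈ o.nodes → (s i).time < o.time → σ.deadline < o.time

/-- The node `v` is overdue at the service `s i`, and is not overdue again at a service between
`s i` and the next service of `O` to `v`. -/
def Critical (R : Finset (Request T)) (n : ℕ) (s : ℕ → Service T) (O : List (Service T)) (i : ℕ)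
    (v : T) : Prop :=
  Overdue R s O i v ∧ ∀ j < n, i < j → v ∈ (s j).nodes → Overdue R s O j v →
    ∃ o ∈ O, v ∈ o.nodes ∧ (s i).time < o.time ∧ o.time ≤ (s j).time

theorem IsTrace.overdue_of_mem_due (h : IsTrace c R n s due p X) (O : List (Service T)) {i : ℕ}
    (hi : i < n) {u : T} (hu : u ∈ path ⊥ (due i).node) : Overdue R s O i u :=
  ⟨due i, h.due_pending i hi, (mem_path.mp hu).2, fun o _ _ ho => by rwa [h.due_deadline i hi]⟩

/-- A request pending at the service `s i` is still pending at the next service to an ancestor of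
its node. -/
theorem IsTrace.exists_isNext_of_pend (h : IsTrace c R n s due p X)
    (hsat : ∀ ρ ∈ R, ∃ i < n, (s i).Satisfies ρ) {i : ℕ} {u : T} {σ : Request T}
    (hσ : σ ∈ pend R s i) (hu : u ≤ σ.node) :
    ∃ j < n, IsNext s u i j ∧ σ ∈ pend R s j := by
  obtain ⟨hσR, harr, hun⟩ := mem_pend.mp hσ
  obtain ⟨k, hk, hkσ⟩ := hsat σ hσR
  have hik : i ≤ k := by
    by_contra hki
    exact hun k (not_le.mp hki) hkσ
  obtain ⟨j, hjk, hj⟩ := exists_isNext hik (h.lower hk hu hkσ.1)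
  have hjn : j < n := hjk.trans_lt hk
  refine ⟨j, hjn, hj, mem_pend.mpr ⟨hσR, harr.trans (h.time_mono hj.1 hjn), fun l hl hlσ => ?_⟩⟩
  rcases lt_or_ge l i with hli | hli
  · exact hun l hli hlσ
  · exact hj.2.2 l hli hl (h.lower (hl.trans hjn) hu hlσ.1)

/-- A node that is overdue but not critical spends its whole budget, on nodes whose next service
finds them overdue. -/
theorem IsTrace.pays_of_not_critical (h : IsTrace c R n s due p X)
    (hsat : ∀ ρ ∈ R, ∃ i < n, (s i).Satisfies ρ) {O : List (Service T)} (hO : IsSolution R O)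
    {i : ℕ} (hi : i < n) {v : T} (hv : v ∈ (s i).nodes) (hover : Overdue R s O i v)
    (hcrit : ¬ Critical R n s O i v) :
    ∑ u, X i v u = c v ∧
      ∀ u, X i v u ≠ 0 → ∃ j < n, IsNext s u i j ∧ Overdue R s O j u := by
  -- Not being critical gives a later overdue service `j` with no service of `O` to `v` in between.
  have hex : ∃ j < n, i < j ∧ Overdue R s O j v ∧
      ∀ o ∈ O, v ∈ o.nodes → (s i).time < o.time → (s j).time < o.time := by
    by_contra hne
    refine hcrit ⟨hover, fun j hj hij _ hjo => ?_⟩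
    by_contra hno
    refine hne ⟨j, hj, hij, hjo, fun o ho hvo hlt => ?_⟩
    by_contra hle
    exact hno ⟨o, ho, hvo, hlt, not_lt.mp hle⟩
  obtain ⟨j, hj, hij, ⟨τ, hτ, hvτ, hτO⟩, hgap⟩ := hex
  have hgap' : ∀ o ∈ O, v ∈ o.nodes → (s i).time < o.time → τ.deadline < o.time :=
    fun o ho hvo hlt => hτO o ho hvo (hgap o ho hvo hlt)
  obtain ⟨hτR, -, hun⟩ := mem_pend.mp hτ
  -- `O` serves `τ`, hence `v`, by the deadline of `τ`. This cannot happen after `s i`, since all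
  -- such services to `v` come too late for `τ`.
  have harr : τ.arrival ≤ (s i).time := by
    obtain ⟨o, ho, ho1, ho2, ho3⟩ := hO.2 τ hτR
    have hvo : v ∈ o.nodes := (hO.1 o ho).2 hvτ ho1
    by_contra hlt
    exact absurd (hgap' o ho hvo ((not_le.mp hlt).trans_le ho2)) (not_lt.mpr ho3)
  have hτi : τ ∈ pend R s i := mem_pend.mpr ⟨hτR, harr, fun k hk => hun k (hk.trans hij)⟩
  have hdl : (s i).time ≤ τ.deadline := by
    obtain ⟨k, hk, hkτ⟩ := hsat τ hτR
    have hjk : j ≤ k := by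
      by_contra hkj
      exact hun k (not_le.mp hkj) hkτ
    exact (h.time_mono (hij.le.trans hjk) hk).trans hkτ.2.2
  have hτS : τ.node ∉ (s i).nodes := fun hmem => hun i hij ⟨hmem, harr, hdl⟩
  obtain ⟨p', -, -, hX⟩ := h.pays i hi
  obtain ⟨h1, h2⟩ := hX.exhausted v hv id τ hτi hvτ hτS
  refine ⟨h1, fun u hu => ?_⟩
  obtain ⟨σ, hσ, huσ, hστ⟩ := h2 u hu
  obtain ⟨k, hk, hnext, hσk⟩ := h.exists_isNext_of_pend hsat hσ huσ
  -- A service of `O` to `u` also contains its ancestor `v`, so it comes after the deadline of `τ`,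
  -- and thus of `σ`.
  refine ⟨k, hk, hnext, σ, hσk, huσ, fun o ho huo hlt => ?_⟩
  exact hστ.trans_lt (hgap' o ho ((hO.1 o ho).2 (hX.lt v u hu).le huo)
    ((h.time_mono hnext.1 hk).trans_lt hlt))

/-! ### ### Comparison with the cost of a solution -/

open Classical in
/-- The pairs of a service and one of its nodes. -/
def served (n : ℕ) (s : ℕ → Service T) : Finset (ℕ × T) :=
  (Finset.range n ×ˢ Finset.univ).filter fun e => e.2 ∈ (s e.1).nodes

theorem mem_served {e : ℕ × T} : e ∈ served n s ↔ e.1 < n ∧ e.2 ∈ (s e.1).nodes := by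
  simp [served]

open Classical in
theorem sum_served (g : ℕ → T → ℝ) : ∑ e ∈ served n s, g e.1 e.2 =
    ∑ i ∈ Finset.range n, ∑ v, if v ∈ (s i).nodes then g i v else 0 := by
  rw [served, Finset.sum_filter, Finset.sum_product]

theorem cost_map_range : cost c ((List.range n).map s) = ∑ e ∈ served n s, c e.2 := by
  classical
  rw [sum_served fun _ v => c v, cost, List.map_map]
  simp only [Finset.sum_ite_mem, Finset.univ_inter]
  induction n with
  | zero => simp
  | succ n ih => rw [List.range_succ, Finset.sum_range_succ, List.map_append,
      List.sum_append, ih]; simp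

open Classical in
/-- Distinct critical services to a node are separated by services of `O` to this node. -/
theorem sum_critical_le_cost (hc : ∀ v, 0 < c v)
    {O : List (Service T)} (hO : IsSolution R O) :
    ∑ e ∈ (served n s).filter (fun e => Critical R n s O e.1 e.2), c e.2 ≤ cost c O := by
  -- The last service of `O` to the node up to `s i`. It exists because the request witnessing that
  -- the node is overdue can only be served by `O` by then. Positions in the list are used since the
  -- cost counts repetitions.
  have hlast : ∀ e : ℕ × T, Critical R n s O e.1 e.2 → ∃ k : Fin O.length,
      e.2 ∈ O[k].nodes ∧ O[k].time ≤ (s e.1).time ∧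
      ∀ o ∈ O, e.2 ∈ o.nodes → o.time ≤ (s e.1).time → o.time ≤ O[k].time := by
    rintro ⟨i, v⟩ ⟨⟨σ, hσ, hvσ, hσO⟩, -⟩
    obtain ⟨o, ho, ho1, ho2, ho3⟩ := hO.2 σ (mem_pend.mp hσ).1
    have hvo : v ∈ o.nodes := (hO.1 o ho).2 hvσ ho1
    have hoi : o.time ≤ (s i).time := by
      by_contra hlt
      exact absurd (hσO o ho hvo (not_le.mp hlt)) (not_lt.mpr ho3)
    obtain ⟨k₀, hk₀, rfl⟩ := List.mem_iff_getElem.mp ho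
    obtain ⟨k, hk, hmax⟩ := Finset.exists_max_image
      (Finset.univ.filter fun k : Fin O.length => v ∈ O[k].nodes ∧ O[k].time ≤ (s i).time)
      (fun k => O[k].time) ⟨⟨k₀, hk₀⟩, by simpa using ⟨hvo, hoi⟩⟩
    simp only [Finset.mem_filter, Finset.mem_univ, true_and] at hk hmax
    refine ⟨k, hk.1, hk.2, fun o' ho' h1 h2 => ?_⟩
    obtain ⟨k', hk', rfl⟩ := List.mem_iff_getElem.mp ho'
    exact hmax ⟨k', hk'⟩ ⟨h1, h2⟩
  have hcost : cost c O = ∑ x ∈ (Finset.univ : Finset (Fin O.length × T)).filter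
      (fun x => x.2 ∈ O[x.1].nodes), c x.2 := by
    rw [Finset.sum_filter, ← Finset.univ_product_univ, Finset.sum_product, cost,
      ← Fin.sum_univ_fun_getElem]
    refine Finset.sum_congr rfl fun k _ => ?_
    rw [← Finset.sum_filter]
    exact Finset.sum_congr (by ext; simp) fun _ _ => rfl
  rcases isEmpty_or_nonempty (Fin O.length) with hemp | hne
  · rw [hcost, Finset.filter_false_of_mem fun e _ he => hemp.elim (hlast e he).choose]
    exact Finset.sum_nonneg fun x _ => (hc x.2).le
  choose! φ hφ using hlast
  have hinj : Set.InjOn (fun e : ℕ × T => (φ e, e.2))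
      ((served n s).filter fun e => Critical R n s O e.1 e.2 : Finset (ℕ × T)) := by
    -- Criticality at `i` puts a service of `O` to `v` after `s i` and up to `s j`, so the last one
    -- up to `s j` differs from the last one up to `s i`.
    have key : ∀ i j v, i < j → (j, v) ∈ served n s → Critical R n s O i v →
        Critical R n s O j v → φ (i, v) = φ (j, v) → False := by
      intro i j v hij hjs hi hj heq
      rw [mem_served] at hjs
      obtain ⟨o, ho, hvo, h1, h2⟩ := hi.2 j hjs.1 hij hjs.2 hj.1
      have h3 := (hφ (j, v) hj).2.2 o ho hvo h2
      rw [← heq] at h3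
      exact absurd (h3.trans (hφ (i, v) hi).2.1) (not_le.mpr h1)
    rintro ⟨i, v⟩ he ⟨j, w⟩ hf heq
    simp only [Finset.coe_filter, Set.mem_ofPred_eq] at he hf
    obtain ⟨h1, rfl⟩ := Prod.mk.inj heq
    rcases lt_trichotomy i j with hij | rfl | hij
    · exact (key i j v hij hf.1 he.2 hf.2 h1).elim
    · rfl
    · exact (key j i v hij he.1 hf.2 he.2 h1.symm).elim
  rw [hcost, ← Finset.sum_image (f := fun x : Fin O.length × T => c x.2) hinj]
  refine Finset.sum_le_sum_of_subset_of_nonneg (fun x hx => ?_) fun x _ _ => (hc x.2).le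
  obtain ⟨e, he, rfl⟩ := Finset.mem_image.mp hx
  simpa using (hφ e (Finset.mem_filter.mp he).2).1

theorem IsTrace.cost_le (h : IsTrace c R n s due p X) (hc : ∀ v, 0 < c v)
    (hsat : ∀ ρ ∈ R, ∃ i < n, (s i).Satisfies ρ) {O : List (Service T)} (hO : IsSolution R O) :
    cost c ((List.range n).map s) ≤ depth T * cost c O := by
  classical
  set x : ℕ × T → ℕ × T → ℝ :=
    fun e f => if IsNext s f.2 e.1 f.1 then X e.1 e.2 f.2 else 0 with hx
  have hin : ∀ f : ℕ × T, ∑ e ∈ served n s, x e f =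
      ∑ i ∈ Finset.range n, ∑ v, (if IsNext s f.2 i f.1 then X i v f.2 else 0) := by
    intro f
    rw [sum_served fun i v => x (i, v) f]
    refine Finset.sum_congr rfl fun i hi => Finset.sum_congr rfl fun v _ => ?_
    obtain ⟨p', -, -, hX⟩ := h.pays i (Finset.mem_range.mp hi)
    by_cases hv : v ∈ (s i).nodes
    · simp only [hv, if_true, hx]
    · simp [hv, hX.payer_mem v hv]
  have hout : ∀ e : ℕ × T, ∑ f ∈ served n s, x e f =
      ∑ u, ∑ j ∈ Finset.range n, (if IsNext s u e.1 j then X e.1 e.2 u else 0) := by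
    intro e
    rw [sum_served fun j u => x e (j, u), Finset.sum_comm]
    refine Finset.sum_congr rfl fun u _ => Finset.sum_congr rfl fun j _ => ?_
    by_cases hu : u ∈ (s j).nodes
    · simp only [hu, if_true, hx]
    · rw [if_neg hu, if_neg fun hn => hu hn.2.1]
  have hmain := sum_le_mul_sum_critical (served n s) (fun e => Overdue R s O e.1 e.2)
    (fun e => Critical R n s O e.1 e.2) (fun e he => he.1) (fun e => c e.2)
    (fun e => (level e.2 : ℝ)) (depth T : ℝ) x ?_ ?_
    (fun e _ => by exact_mod_cast level_le_depth e.2) (fun e _ => by exact_mod_cast one_le_level e.2)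
    ?_ ?_ ?_ ?_ ?_
  · rw [cost_map_range]
    refine hmain.trans (mul_le_mul_of_nonneg_left ?_ (Nat.cast_nonneg _))
    exact sum_critical_le_cost hc hO
  · intro e he f _
    simp only [hx]
    split_ifs
    exacts [h.nonneg (mem_served.mp he).1 _ _, le_rfl]
  · intro e he f _ hne
    simp only [hx, ne_eq, ite_eq_right_iff, Classical.not_imp] at hne
    obtain ⟨p', -, -, hX⟩ := h.pays e.1 (mem_served.mp he).1
    exact_mod_cast level_lt_level (hX.lt _ _ hne.2)
  · intro f hf
    rw [hin]
    exact h.received_le (mem_served.mp hf).1 (mem_served.mp hf).2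
  · intro f hf hnot
    rw [hin]
    exact h.received_eq (mem_served.mp hf).1 (mem_served.mp hf).2
      fun hd => hnot (h.overdue_of_mem_due O (mem_served.mp hf).1 hd)
  -- Payments to nodes that are never served again are dropped, which only lowers the sum.
  · intro e he
    obtain ⟨p', -, -, hX⟩ := h.pays e.1 (mem_served.mp he).1
    rw [hout]
    exact (Finset.sum_le_sum fun u _ => sum_ite_isNext_le s u e.1 n (hX.nonneg e.2 u)).trans
      (hX.sum_le e.2)
  -- Here nothing is dropped: every paid node has a next service.
  · intro e he hover hcrit
    obtain ⟨h1, h2⟩ := h.pays_of_not_critical hsat hO (mem_served.mp he).1 (mem_served.mp he).2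
      hover hcrit
    rw [hout, ← h1]
    refine Finset.sum_congr rfl fun u _ => ?_
    by_cases hu : X e.1 e.2 u = 0
    · simp [hu]
    · obtain ⟨j, hj, hnext, -⟩ := h2 u hu
      exact sum_ite_isNext_of_exists hj hnext _
  · intro e he hover hcrit f _ hne
    simp only [hx, ne_eq, ite_eq_right_iff, Classical.not_imp] at hne
    obtain ⟨-, h2⟩ := h.pays_of_not_critical hsat hO (mem_served.mp he).1 (mem_served.mp he).2
      hover hcrit
    obtain ⟨j, -, hnext, hj⟩ := h2 f.2 hne.2
    rwa [hne.1.unique hnext]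

end Trace

end

end MLAPD

theorem mainTheorem1 (T : RootedTree) [Fintype T] (c : T → ℝ) (hc : ∀ v, 0 < c v)
    (E : MLAPD.EnqueueRule T) :
    MLAPD.IsCompetitive c (MLAPD.waterfall c E) (MLAPD.depth T : ℝ) := by
  refine ⟨MLAPD.isOnline_waterfall c E, fun R hR => ?_⟩
  obtain ⟨n, s, due, p, X, h, hrun, hsat⟩ := MLAPD.exists_trace_waterfall hc E hR
  rw [hrun]
  refine ⟨⟨fun t ht => ?_, fun ρ hρ => ?_⟩, fun O hO => h.cost_le hc hsat hO⟩
  · obtain ⟨i, hi, rfl⟩ := List.mem_map.mp ht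
    exact h.isValid (List.mem_range.mp hi)
  · obtain ⟨i, hi, hiρ⟩ := hsat ρ hρ
    exact ⟨s i, List.mem_map.mpr ⟨i, List.mem_range.mpr hi, rfl⟩, hiρ⟩
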